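/- Let $\mathbb{Q}^{alg}$ be the algebraic closure of $\mathbb{Q}$ in $\mathbb{C}$, and assume Schanuel's Conjecture: whenever $\lambda_1,\dots,\lambda_n\in\mathbb{C}$ are linearly independent over $\mathbb{Q}$, the field $\mathbb{Q}(\lambda_1,\dots,\lambda_n,e^{\lambda_1},\dots,e^{\lambda_n})$ has transcendence degree at least $n$ over $\mathbb{Q}$. Let $p(x,y)\in\mathbb{Q}^{alg}[x,y]$ be an irreducible polynomial depending on both $x$ and $y$, and let $$V=\{(z_1,z_2,w_1,w_2)\in\mathbb{C}^2\times(\mathbb{C}^*)^2 : p(z_1,w_2)=0,\ w_1=z_2\}.$$ Then $\dim V=2$, and $V$ intersects the graph of exponentiation $\{(z_1,z_2,w_1,w_2): w_1=e^{z_1},\ w_2=e^{z_2}\}$ in a generic point: there is $w\in\mathbb{C}$ such that $(w,e^w,e^w,e^{e^w})\in V$ and $$\mathrm{t.d.}_{\mathbb{Q}}(w,e^w,e^w,e^{e^w})=\dim V=2.$$ Equivalently, the equation $p(z,e^{e^z})=0$ has a solution $w\in\mathbb{C}$ such that $w$ and $e^w$ are linearly independent over $\mathbb{Q}$. In fact,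 for every solution $w$ of $p(z,e^{e^z})=0$, one has $\mathrm{t.d.}_{\mathbb{Q}}(w,e^w,e^w,e^{e^w})=2$ if and only if $w$ and $e^w$ are linearly independent over $\mathbb{Q}$. -/

import Mathlib

open Complex MvPolynomial

noncomputable section

/-- The transcendence degree over `ℚ` of the field generated by a set of complex numbers. -/
def td (S : Set ℂ) : Cardinal :=
  Algebra.trdeg ℚ (IntermediateField.adjoin ℚ S)

/-- Schanuel's Conjecture. -/
def SchanuelConjecture : Prop :=
  ∀ (n : ℕ) (l : Fin n → ℂ), LinearIndependent ℚ l →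
    (n : Cardinal) ≤ td (Set.range l ∪ Set.range fun i => exp (l i))

/-- `G_n(ℂ) = ℂ^n × (ℂ^*)^n`, inside the affine space with coordinates
`z_i` (index `Sum.inl i`) and `w_i` (index `Sum.inr i`). -/
def GSpace (n : ℕ) : Set (Fin n ⊕ Fin n → ℂ) :=
  {v | ∀ i, v (Sum.inr i) ≠ 0}

/-- The graph of exponentiation in `G_n(ℂ)`: the points with `w_i = exp z_i` for all `i`. -/
def expGraph (n : ℕ) : Set (Fin n ⊕ Fin n → ℂ) :=
  {v | ∀ i, v (Sum.inr i) = exp (v (Sum.inl i))}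

/-- The dimension of an algebraic subset of `G_n(ℂ)`: the Krull dimension of the
coordinate ring of its Zariski closure in affine space. -/
def algDim {n : ℕ} (V : Set (Fin n ⊕ Fin n → ℂ)) : WithBot ℕ∞ :=
  ringKrullDim (MvPolynomial (Fin n ⊕ Fin n) ℂ ⧸ vanishingIdeal ℂ V)

/-- A generic point of `V`: a point of `V` whose transcendence degree over `ℚ` is `dim V`. -/
def IsGenericPt {n : ℕ} (V : Set (Fin n ⊕ Fin n → ℂ)) (v : Fin n ⊕ Fin n → ℂ) : Prop :=
  v ∈ V ∧ ((Cardinal.toENat (td (Set.range v)) : ℕ∞) : WithBot ℕ∞) = algDim V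

/-- The algebraic set `p(z₁, w₂) = 0`, `w₁ = z₂` in `G_2(ℂ)`. -/
def varietyOf (p : MvPolynomial (Fin 2) (algebraicClosure ℚ ℂ)) : Set (Fin 2 ⊕ Fin 2 → ℂ) :=
  {v | v ∈ GSpace 2 ∧ aeval ![v (Sum.inl 0), v (Sum.inr 1)] p = 0 ∧
    v (Sum.inr 0) = v (Sum.inl 1)}

/-- The point `(z₁, z₂, w₁, w₂) = (w, e^w, e^w, e^{e^w})`. -/
def expPoint (w : ℂ) : Fin 2 ⊕ Fin 2 → ℂ :=
  Sum.elim ![w, exp w] ![exp w, exp (exp w)]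

end

/-! Solutions exist without any conjecture. Put N = 2πi(j+1) and w = N + log s with s = 2πiK + r log
N + z. Then e^w = s is o(N), w ~ N, and e^{e^w} = N^r e^z. If m₀ + r m₁ = M supports a suitable edge
of the Newton polygon of p, then p(w, e^{e^w}) / N^M tends, uniformly for bounded z, to an edge
polynomial in e^z, and Hurwitz's argument yields solutions with e^w/w as small as desired
(`exists_eval_exp_exp_eq_zero`).

Suppose w and e^w were dependent for every solution. If w ≠ 0 then e^w = qw with q = n/d rational, w
is transcendental by Schanuel, and (w, e^{e^w}) is a generic point of p = 0 lying on y^d = (qx)^n.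
Hence p divides the equation of that curve, and two different q would force a nonzero power of a
solution to be rational. So q depends only on p (`eq_of_exp_eq_mul`), contradicting the existence of
solutions with ever smaller e^w/w.

For transcendence degrees, the relation p leaves at most 2, a rational dependence leaves at most 1,
and Schanuel gives at least 2 under independence. The dimension is 2 because V is the part w₂ ≠ 0 of
the curve p = 0, times ℂ^*. -/

/-! ### Transcendence degree and algebraic relations -/

open scoped IntermediateField.algebraAdjoinAdjoin in
theorem td_le_card {S T : Set ℂ}
    (h : ∀ x ∈ S, IsAlgebraic (IntermediateField.adjoin ℚ T) x) : td S ≤ Cardinal.mk T := by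
  let A := Algebra.adjoin ℚ T
  let F := IntermediateField.adjoin ℚ T
  let E := algebraicClosure F ℂ
  have hA : Algebra.trdeg ℚ A ≤ Cardinal.mk T := by
    have hr : A = (aeval (R := ℚ) ((↑) : T → ℂ)).range := by
      rw [← Algebra.adjoin_range_eq_range_aeval, Subtype.range_coe]
    have := _root_.trdeg_le_of_surjective
      (aeval (R := ℚ) ((↑) : T → ℂ)).rangeRestrict (AlgHom.rangeRestrict_surjective _)
    rw [hr]
    exact this.trans (by simp [MvPolynomial.trdeg_of_isDomain])
  have hF : Algebra.trdeg ℚ F ≤ Cardinal.mk T := by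
    have : Algebra.IsAlgebraic A F := inferInstanceAs
      (Algebra.IsAlgebraic (Algebra.adjoin ℚ T) (IntermediateField.adjoin ℚ T))
    have := _root_.trdeg_add_eq ℚ A (A := F)
    rw [_root_.trdeg_eq_zero (R := A) (A := F), add_zero] at this
    exact this ▸ hA
  have hE : Algebra.trdeg ℚ E = Algebra.trdeg ℚ F := by
    have := _root_.trdeg_add_eq ℚ F (A := E)
    rw [_root_.trdeg_eq_zero (R := F) (A := E), add_zero] at this
    exact this.symm
  have hle : IntermediateField.adjoin ℚ S ≤ E.restrictScalars ℚ := by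
    rw [IntermediateField.adjoin_le_iff]
    intro x hx
    exact mem_algebraicClosure_iff.2 (h x hx)
  exact (_root_.trdeg_le_of_injective (IntermediateField.inclusion hle)
    (IntermediateField.inclusion_injective hle)).trans (hE.le.trans hF)

theorem isAlgebraic_adjoin_of_mem {T : Set ℂ} {x : ℂ} (h : x ∈ T) :
    IsAlgebraic (IntermediateField.adjoin ℚ T) x :=
  isAlgebraic_algebraMap (⟨x, IntermediateField.subset_adjoin ℚ T h⟩ : IntermediateField.adjoin ℚ T)

theorem IsAlgebraic.adjoin_of_rat {x : ℂ} (h : IsAlgebraic ℚ x) (T : Set ℂ) :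
    IsAlgebraic (IntermediateField.adjoin ℚ T) x :=
  h.tower_top _

theorem isAlgebraic_adjoin_mono {F E : Type*} [Field F] [Field E] [Algebra F E] {S T : Set E}
    (hST : S ⊆ T) {x : E} (h : IsAlgebraic (IntermediateField.adjoin F S) x) :
    IsAlgebraic (IntermediateField.adjoin F T) x := by
  let i := IntermediateField.inclusion (IntermediateField.adjoin.mono F S T hST)
  let _ := i.toRingHom.toAlgebra
  have : IsScalarTower (IntermediateField.adjoin F S) (IntermediateField.adjoin F T) E :=
    IsScalarTower.of_algebraMap_eq fun _ => rfl
  exact h.tower_top _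

theorem IsAlgebraic.of_pow_mul_eq_pow {K : Type*} [Field K] [Algebra K ℂ] {x y : ℂ} {n a b : ℕ}
    (hn : n ≠ 0) (hx : IsAlgebraic K x) (hx0 : x ≠ 0) (h : y ^ n * x ^ b = x ^ a) :
    IsAlgebraic K y := by
  have : y ^ n = x ^ a * (x ^ b)⁻¹ := by
    rw [← h]; field_simp
  refine _root_.IsAlgebraic.of_pow (Nat.pos_of_ne_zero hn) ?_
  rw [this]
  exact (hx.pow a).mul (hx.pow b).inv

theorem not_algebraicIndependent_of_aeval_eq_zero
    {F E : Type*} [Field F] [Field E] [Algebra F E]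
    {p : MvPolynomial (Fin 2) (algebraicClosure F E)} (hp : p ≠ 0) {x y : E}
    (h : aeval ![x, y] p = 0) : ¬ AlgebraicIndependent F ![x, y] := by
  intro hi
  have hi' := hi.extendScalars (algebraicClosure F E)
  exact hp (hi' (by simpa using h))

-- Independence over `F` persists over its algebraic closure, so a relation with algebraic
-- coefficients already excludes it.
open scoped IntermediateField.algebraAdjoinAdjoin in
theorem isAlgebraic_or_of_aeval_eq_zero
    {F E : Type*} [Field F] [Field E] [Algebra F E]
    {p : MvPolynomial (Fin 2) (algebraicClosure F E)} (hp : p ≠ 0) {x y : E}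
    (h : aeval ![x, y] p = 0) :
    IsAlgebraic F x ∨ IsAlgebraic (IntermediateField.adjoin F {x}) y := by
  by_contra! hc
  obtain ⟨hx, hy⟩ := hc
  refine not_algebraicIndependent_of_aeval_eq_zero hp h ?_
  have hx' : AlgebraicIndependent F fun _ : Unit => x :=
    algebraicIndependent_unique_type_iff.2 hx
  have hy' : Transcendental (Algebra.adjoin F (Set.range fun _ : Unit => x)) y := by
    rw [Set.range_const]
    intro hy'
    exact hy ((IsFractionRing.isAlgebraic_iff (Algebra.adjoin F {x})
      (IntermediateField.adjoin F {x}) E).1 hy')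
  have := (AlgebraicIndependent.option_iff (a := y)).2 ⟨hx', hy'⟩
  have h2 := this.comp (fun i : Fin 2 => if i = 0 then some () else none) (by decide)
  convert h2 using 1
  ext i
  fin_cases i <;> rfl

/-! ### Prime ideals in two variables -/

/-- An irreducible polynomial in two variables over an algebraically closed field
does not generate a maximal ideal. -/
theorem not_isMaximal_span_singleton {k : Type*} [Field k] [IsAlgClosed k]
    {q : MvPolynomial (Fin 2) k} (hq : Irreducible q) : ¬ (Ideal.span {q}).IsMaximal := by
  intro h
  obtain ⟨a, ha⟩ := isMaximal_iff_eq_vanishingIdeal_singleton.1 h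
  -- Dividing a polynomial in one variable alone kills the degree in the other; both together make
  -- `q` constant.
  have hdvd (i : Fin 2) : q ∣ X i - C (a i) := by
    rw [← Ideal.mem_span_singleton, ha]
    simp
  have hdeg (i j : Fin 2) (hij : i ≠ j) : degreeOf j q = 0 := by
    obtain ⟨u, hu⟩ := hdvd i
    have hne : (X i - C (a i) : MvPolynomial (Fin 2) k) ≠ 0 := by
      intro h
      have := congrArg (eval fun _ => a i + 1) h
      simp at this
    have hu0 : u ≠ 0 := by
      rintro rfl
      exact hne (by rw [hu, mul_zero])
    have h1 : degreeOf j (X i - C (a i) : MvPolynomial (Fin 2) k) ≤ 0 := by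
      refine (degreeOf_sub_le _ _ _).trans ?_
      simp [degreeOf_C, degreeOf_X_of_ne hij.symm]
    rw [hu, degreeOf_mul_eq hq.ne_zero hu0] at h1
    omega
  have hvars : q.vars = ∅ := by
    rw [Finset.eq_empty_iff_forall_notMem]
    intro j
    rw [vars_def, Multiset.mem_toFinset, ← Multiset.count_eq_zero, ← degreeOf_def]
    fin_cases j
    · exact hdeg 1 0 (by decide)
    · exact hdeg 0 1 (by decide)
  obtain ⟨c, rfl⟩ : ∃ c, q = C c := ⟨_, vars_eq_empty_iff_eq_C.1 hvars⟩
  exact hq.not_isUnit ((isUnit_iff_ne_zero.2 fun hc => hq.ne_zero (by rw [hc, C_0])).map C)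

theorem one_le_ringKrullDim_quotient_span {k : Type*} [Field k] [IsAlgClosed k]
    {q : MvPolynomial (Fin 2) k} (hq : Irreducible q) :
    1 ≤ ringKrullDim (MvPolynomial (Fin 2) k ⧸ Ideal.span {q}) := by
  have hp : (Ideal.span {q}).IsPrime := (Ideal.span_singleton_prime hq.ne_zero).2 hq.prime
  by_contra! h
  have : Ring.KrullDimLE 0 (MvPolynomial (Fin 2) k ⧸ Ideal.span {q}) := by
    rw [Ring.krullDimLE_iff]
    exact Order.le_of_lt_succ h
  have hf := Ring.KrullDimLE.isField_of_isDomain (R := MvPolynomial (Fin 2) k ⧸ Ideal.span {q})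
  exact not_isMaximal_span_singleton hq (Ideal.Quotient.maximal_of_isField _ hf)

theorem ringKrullDim_quotient_span_le_one {k : Type*} [Field k] {q : MvPolynomial (Fin 2) k}
    (hq : q ≠ 0) : ringKrullDim (MvPolynomial (Fin 2) k ⧸ Ideal.span {q}) ≤ 1 := by
  have h := ringKrullDim_quotient_succ_le_of_nonZeroDivisor (mem_nonZeroDivisors_of_ne_zero hq)
  rw [MvPolynomial.ringKrullDim_of_isNoetherianRing, ringKrullDim_eq_zero_of_field] at h
  have h2 : ((Nat.card (Fin 2) : ℕ) : WithBot ℕ∞) = 1 + 1 := by simp; norm_num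
  rw [zero_add, h2] at h
  exact ENat.WithBot.add_le_add_one_right_iff.1 h

/-- The quotient by `q` is a domain of dimension at most one, so its nonzero primes are maximal. -/
theorem isMaximal_of_irreducible_mem {k : Type*} [Field k] {q : MvPolynomial (Fin 2) k}
    (hq : Irreducible q) {P : Ideal (MvPolynomial (Fin 2) k)} [P.IsPrime] (hqP : q ∈ P)
    (hne : P ≠ Ideal.span {q}) : P.IsMaximal := by
  have hp : (Ideal.span {q}).IsPrime := (Ideal.span_singleton_prime hq.ne_zero).2 hq.prime
  have hle : Ideal.span {q} ≤ P := (Ideal.span_singleton_le_iff_mem P).2 hqP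
  have hdim : Ring.KrullDimLE 1 (MvPolynomial (Fin 2) k ⧸ Ideal.span {q}) :=
    Ring.krullDimLE_iff.2 (by simpa using ringKrullDim_quotient_span_le_one hq.ne_zero)
  have hker : RingHom.ker (Ideal.Quotient.mk (Ideal.span {q})) ≤ P := by
    rwa [Ideal.mk_ker]
  have hprime := Ideal.map_isPrime_of_surjective Ideal.Quotient.mk_surjective hker
  have hmax := Ring.krullDimLE_one_iff_of_noZeroDivisors.1 hdim
    (P.map (Ideal.Quotient.mk (Ideal.span {q})))
    (fun h => hne (le_antisymm (by
      rw [Ideal.map_eq_bot_iff_le_ker, Ideal.mk_ker] at h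
      exact h) hle)) hprime
  have := Ideal.comap_isMaximal_of_surjective (Ideal.Quotient.mk (Ideal.span {q}))
    Ideal.Quotient.mk_surjective (K := P.map (Ideal.Quotient.mk (Ideal.span {q})))
  rwa [Ideal.comap_map_of_surjective' _ Ideal.Quotient.mk_surjective, Ideal.mk_ker,
    sup_eq_left.2 hle] at this

/-! ### The dimension of V -/

/-- Membership in `varietyOf p`, with `p` regarded as a polynomial over `ℂ`. -/
theorem mem_varietyOf_iff {p : MvPolynomial (Fin 2) (algebraicClosure ℚ ℂ)}
    {v : Fin 2 ⊕ Fin 2 → ℂ} : v ∈ varietyOf p ↔ (∀ i, v (Sum.inr i) ≠ 0) ∧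
      eval ![v (Sum.inl 0), v (Sum.inr 1)] (map (algebraMap _ ℂ) p) = 0 ∧
      v (Sum.inr 0) = v (Sum.inl 1) := by
  rw [eval_map, ← aeval_def]
  rfl

theorem algDim_varietyOf_le {p : MvPolynomial (Fin 2) (algebraicClosure ℚ ℂ)} (hp : p ≠ 0) :
    algDim (varietyOf p) ≤ 2 := by
  set P := map (algebraMap _ ℂ) p with hP
  have hP0 : P ≠ 0 := by
    rw [← support_nonempty,
      support_map_of_injective _ (algebraMap (algebraicClosure ℚ ℂ) ℂ).injective, support_nonempty]
    exact hp
  set I := vanishingIdeal ℂ (varietyOf p)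
  let φ : MvPolynomial (Fin 2) ℂ →+* MvPolynomial (Fin 2 ⊕ Fin 2) ℂ ⧸ I :=
    (Ideal.Quotient.mk I).comp
      (aeval (R := ℂ) ![X (Sum.inl 0), X (Sum.inr 1)]).toRingHom
  have hφ : ∀ a ∈ Ideal.span {P}, φ a = 0 := by
    intro a ha
    obtain ⟨b, rfl⟩ := Ideal.mem_span_singleton.1 ha
    rw [map_mul]
    refine mul_eq_zero_of_left (Ideal.Quotient.eq_zero_iff_mem.2 ?_) _
    rw [mem_vanishingIdeal_iff]
    intro v hv
    have := (mem_varietyOf_iff.1 hv).2.1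
    rw [← this, ← hP]
    change aeval v (aeval _ P) = _
    rw [← AlgHom.comp_apply, ← coe_aeval_eq_eval]
    change _ = aeval _ P
    congr 1
    ext i
    fin_cases i <;> simp
  -- The polynomial variable goes to the common value z₂ = w₁, the free coordinate of V.
  let ψ := Polynomial.eval₂RingHom (Ideal.Quotient.lift _ φ hφ)
    (Ideal.Quotient.mk I (X (Sum.inl 1)))
  have hψ : Function.Surjective ψ := by
    intro a
    obtain ⟨a, rfl⟩ := Ideal.Quotient.mk_surjective a
    change a ∈ (ψ.range.comap (Ideal.Quotient.mk I))
    induction a using MvPolynomial.induction_on with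
    | C c =>
      refine ⟨Polynomial.C (Ideal.Quotient.mk _ (C c)), ?_⟩
      simp [ψ, φ]
    | add a b ha hb => exact add_mem ha hb
    | mul_X a i ha =>
      refine mul_mem ha ?_
      have h2 : X (Sum.inl 1) ∈ (ψ.range.comap (Ideal.Quotient.mk I)) :=
        ⟨Polynomial.X, by simp [ψ]⟩
      rcases i with i | i <;> fin_cases i
      · exact ⟨Polynomial.C (Ideal.Quotient.mk _ (X 0)), by simp [ψ, φ]⟩
      · exact h2
      · have : Ideal.Quotient.mk I (X (Sum.inr 0)) = Ideal.Quotient.mk I (X (Sum.inl 1)) := by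
          rw [Ideal.Quotient.mk_eq_mk_iff_sub_mem, mem_vanishingIdeal_iff]
          intro v hv
          simpa [sub_eq_zero] using (mem_varietyOf_iff.1 hv).2.2
        change Ideal.Quotient.mk I (X (Sum.inr 0)) ∈ ψ.range
        rw [this]
        exact h2
      · exact ⟨Polynomial.C (Ideal.Quotient.mk _ (X 1)), by simp [ψ, φ]⟩
  calc _ ≤ _ := ringKrullDim_le_of_surjective ψ hψ
    _ = _ := Polynomial.ringKrullDim_of_isNoetherianRing
    _ ≤ 1 + 1 := add_le_add_left (ringKrullDim_quotient_span_le_one hP0) 1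
    _ = 2 := one_add_one_eq_two

theorem two_le_algDim_varietyOf {p : MvPolynomial (Fin 2) (algebraicClosure ℚ ℂ)}
    (hA : ∃ m ∈ p.support, m 1 = 0) (hB : ∃ m ∈ p.support, m 1 ≠ 0) :
    2 ≤ algDim (varietyOf p) := by
  set P := map (algebraMap _ ℂ) p with hP
  have hsupp : P.support = p.support :=
    support_map_of_injective _ (algebraMap (algebraicClosure ℚ ℂ) ℂ).injective
  obtain ⟨A, hA, hA1⟩ := hA
  obtain ⟨B, hB, hB1⟩ := hB
  have hP0 : P ≠ 0 := by
    rw [← support_nonempty, hsupp]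
    exact ⟨A, hA⟩
  have hPu : ¬ IsUnit P := by
    intro h
    refine mem_support_iff.1 (hsupp ▸ hB) ?_
    exact ((MvPolynomial.isUnit_iff.1 h).2 B (by rintro rfl; simp at hB1)).eq_zero
  -- One factor over ℂ suffices, so absolute irreducibility of `p` is not needed.
  obtain ⟨q, hq, hqP⟩ := WfDvdMonoid.exists_irreducible_factor hPu hP0
  have hqX : ¬ q ∣ X 1 := by
    intro h
    have hXq : X 1 ∣ q := (hq.associated_of_dvd (X_prime (i := 1)).irreducible h).symm.dvd
    obtain ⟨u, hu⟩ := hXq.trans hqP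
    refine mem_support_iff.1 (hsupp ▸ hA) ?_
    rw [hu, mul_comm, coeff_mul_X', if_neg (by simpa using hA1)]
  have hprime : (Ideal.span {q}).IsPrime := (Ideal.span_singleton_prime hq.ne_zero).2 hq.prime
  let D := MvPolynomial (Fin 2) ℂ ⧸ Ideal.span {q}
  let ψ : MvPolynomial (Fin 2 ⊕ Fin 2) ℂ →ₐ[ℂ] Polynomial D :=
    aeval (Sum.elim ![Polynomial.C (Ideal.Quotient.mk (Ideal.span {q}) (X 0) : D), Polynomial.X]
      ![Polynomial.X, Polynomial.C (Ideal.Quotient.mk (Ideal.span {q}) (X 1) : D)])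
  have hψ : Function.Surjective ψ := by
    intro a
    change a ∈ ψ.range
    induction a using Polynomial.induction_on' with
    | add a b ha hb => exact add_mem ha hb
    | monomial n a =>
      have hX : Polynomial.X ∈ ψ.range := ⟨X (Sum.inl 1), by simp [ψ]⟩
      rw [← Polynomial.C_mul_X_pow_eq_monomial]
      refine mul_mem ?_ (pow_mem hX n)
      obtain ⟨a, rfl⟩ := Ideal.Quotient.mk_surjective a
      refine ⟨aeval ![X (Sum.inl 0), X (Sum.inr 1)] a, ?_⟩
      let θ : MvPolynomial (Fin 2) ℂ →ₐ[ℂ] Polynomial D :=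
        (IsScalarTower.toAlgHom ℂ D (Polynomial D)).comp (Ideal.Quotient.mkₐ ℂ _)
      change (ψ.comp (aeval _)) a = θ a
      congr 1
      ext i
      fin_cases i <;> simp [ψ, θ] <;> rfl
  have hI : ∀ g ∈ vanishingIdeal ℂ (varietyOf p), ψ g = 0 := by
    intro g hg
    have key : ∀ t : ℂ, t ≠ 0 → (ψ g).IsRoot (algebraMap ℂ D t) := by
      intro t ht
      let ρ : MvPolynomial (Fin 2 ⊕ Fin 2) ℂ →ₐ[ℂ] MvPolynomial (Fin 2) ℂ :=
        aeval (Sum.elim ![X 0, C t] ![C t, X 1])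
      have h1 : (ψ g).eval (algebraMap ℂ D t) = Ideal.Quotient.mk _ (ρ g) := by
        change ((Polynomial.aeval (R := D) (algebraMap ℂ D t)).restrictScalars ℂ).comp ψ g =
          ((Ideal.Quotient.mkₐ ℂ (Ideal.span {q})).comp ρ) g
        congr 1
        ext i
        rcases i with i | i <;> fin_cases i <;> simp [ψ, ρ] <;> rfl
      rw [Polynomial.IsRoot, h1, Ideal.Quotient.eq_zero_iff_mem]
      -- Points with w₂ = 0 are not in V; the factor `X 1` covers them, and is cancelled since `q`
      -- does not divide it.
      have h2 : X 1 * ρ g ∈ Ideal.span {q} := by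
        rw [← IsPrime.vanishingIdeal_zeroLocus (K := ℂ) (Ideal.span {q}), mem_vanishingIdeal_iff]
        intro v hv
        rw [zeroLocus_span] at hv
        have hv : eval v q = 0 := hv q rfl
        rw [map_mul, aeval_X]
        by_cases hv1 : v 1 = 0
        · rw [hv1, zero_mul]
        refine mul_eq_zero_of_right _ ?_
        have hmem : Sum.elim ![v 0, t] ![t, v 1] ∈ varietyOf p := by
          refine mem_varietyOf_iff.2 ⟨fun i => ?_, ?_, rfl⟩
          · fin_cases i
            · exact ht
            · exact hv1
          · have hvv : ![v 0, v 1] = v := by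
              ext i
              fin_cases i <;> rfl
            obtain ⟨u, hu⟩ := hqP
            change eval ![v 0, v 1] P = 0
            rw [hvv, hu, map_mul, hv, zero_mul]
        rw [← mem_vanishingIdeal_iff.1 hg _ hmem]
        change ((aeval v).comp ρ) g = _
        congr 1
        ext i
        rcases i with i | i <;> fin_cases i <;> simp [ρ]
      refine (hprime.mem_or_mem h2).resolve_left ?_
      rwa [Ideal.mem_span_singleton]
    refine Polynomial.eq_zero_of_infinite_isRoot _ (Set.Infinite.mono ?_
      ((Set.finite_singleton (0 : ℂ)).infinite_compl.image
        (FaithfulSMul.algebraMap_injective ℂ D).injOn))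
    rintro _ ⟨t, ht, rfl⟩
    exact key t ht
  have hs := Ideal.Quotient.lift_surjective_of_surjective
    (vanishingIdeal ℂ (varietyOf p)) (f := ψ.toRingHom) hI hψ
  calc (2 : WithBot ℕ∞) = 1 + 1 := one_add_one_eq_two.symm
    _ ≤ ringKrullDim D + 1 := add_le_add_left (one_le_ringKrullDim_quotient_span hq) 1
    _ ≤ _ := ringKrullDim_succ_le_ringKrullDim_polynomial
    _ ≤ _ := ringKrullDim_le_of_surjective _ hs

/-! ### Hurwitz's argument and the Newton edge -/

-- If `F n` had no zero, the maximum principle for `1 / F n` would fail: |F n| ≥ 2m/3 on the circle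
-- but < m/3 at the centre.
open Filter Topology Metric in
theorem exists_zero_of_tendstoUniformlyOn {F : ℕ → ℂ → ℂ} {f : ℂ → ℂ} {c : ℂ} {r : ℝ} (hr : 0 < r)
    (hF : ∀ n, DiffContOnCl ℂ (F n) (ball c r))
    (h : TendstoUniformlyOn F f atTop (closedBall c r))
    (hf : ContinuousOn f (sphere c r)) (hc : f c = 0) (hs : ∀ z ∈ sphere c r, f z ≠ 0) :
    ∀ᶠ n in atTop, ∃ z ∈ closedBall c r, F n z = 0 := by
  obtain ⟨z₀, hz₀, hmin⟩ := (isCompact_sphere c r).exists_isMinOn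
    (NormedSpace.sphere_nonempty.2 hr.le) hf.norm
  set m := ‖f z₀‖ with hm
  have hm0 : 0 < m := norm_pos_iff.2 (hs z₀ hz₀)
  filter_upwards [Metric.tendstoUniformlyOn_iff.1 h (m / 3) (by positivity)] with n hn
  by_contra! hne
  have hcn := hn c (mem_closedBall_self hr.le)
  rw [hc, dist_zero_left] at hcn
  have hd : DiffContOnCl ℂ (F n)⁻¹ (ball c r) :=
    (hF n).inv fun z hz => hne z (closure_ball_subset_closedBall hz)
  have hle := norm_le_of_forall_mem_frontier_norm_le isBounded_ball hd (C := (2 * m / 3)⁻¹)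
    (fun z hz => by
      rw [frontier_ball c hr.ne'] at hz
      have h1 := hn z (sphere_subset_closedBall hz)
      have h2 : m ≤ ‖f z‖ := hmin hz
      rw [dist_eq_norm] at h1
      have h3 := norm_sub_norm_le (f z) (F n z)
      rw [Pi.inv_apply, norm_inv]
      apply inv_anti₀ (by positivity)
      linarith) (subset_closure (mem_ball_self hr))
  rw [Pi.inv_apply, norm_inv, inv_le_inv₀ (norm_pos_iff.2 (hne c (mem_closedBall_self hr.le)))
    (by positivity)] at hle
  linarith

/-- Start from the highest monomial `A` free of the second variable; `-r` is the largest slope from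
`A` to the other monomials. -/
theorem exists_newton_edge {S : Finset (Fin 2 →₀ ℕ)} (hA : ∃ m ∈ S, m 1 = 0)
    (hB : ∃ m ∈ S, m 1 ≠ 0) :
    ∃ r M : ℝ, (∀ m ∈ S, m 0 + r * m 1 ≤ M) ∧ (∃ m ∈ S, m 1 = 0 ∧ (m 0 + r * m 1 : ℝ) = M) ∧
      ∃ m ∈ S, m 1 ≠ 0 ∧ (m 0 + r * m 1 : ℝ) = M := by
  obtain ⟨A, hA, hAmax⟩ := (S.filter (· 1 = 0)).exists_max_image (· 0)
    (by simpa [Finset.Nonempty] using hA)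
  obtain ⟨B, hB, hBmax⟩ := (S.filter (· 1 ≠ 0)).exists_max_image
    (fun m => ((m 0 : ℝ) - A 0) / m 1) (by simpa [Finset.Nonempty] using hB)
  rw [Finset.mem_filter] at hA hB
  have hB1 : (B 1 : ℝ) ≠ 0 := by exact_mod_cast hB.2
  refine ⟨-(((B 0 : ℝ) - A 0) / B 1), A 0, fun m hm => ?_, ⟨A, hA.1, hA.2, by simp [hA.2]⟩,
    B, hB.1, hB.2, by field_simp; ring⟩
  by_cases h : m 1 = 0
  · have : m 0 ≤ A 0 := hAmax m (by simp [hm, h])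
    simpa [h] using this
  · have h1 := hBmax m (by simp [hm, h])
    have h2 : (0 : ℝ) < m 1 := by positivity
    rw [div_le_iff₀ h2] at h1
    linarith

/-- The edge polynomial of `p` on the line `m₀ + r m₁ = M`. -/
noncomputable def edgePoly (p : MvPolynomial (Fin 2) ℂ) (r M : ℝ) : Polynomial ℂ :=
  ∑ m ∈ p.support, if (m 0 + r * m 1 : ℝ) = M then
    Polynomial.C (p.coeff m) * Polynomial.X ^ m 1 else 0

/-- On the line, `m 1` determines `m 0`, so distinct monomials cannot cancel. -/
theorem coeff_edgePoly_ne_zero {p : MvPolynomial (Fin 2) ℂ} {r M : ℝ} {m : Fin 2 →₀ ℕ}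
    (hm : m ∈ p.support) (h : (m 0 + r * m 1 : ℝ) = M) : (edgePoly p r M).coeff (m 1) ≠ 0 := by
  have : (edgePoly p r M).coeff (m 1) = p.coeff m := by
    rw [edgePoly, Polynomial.finsetSum_coeff, Finset.sum_eq_single_of_mem m hm]
    · simp [h]
    · intro n _ hn
      split_ifs with h'
      · rw [Polynomial.coeff_C_mul, Polynomial.coeff_X_pow, if_neg, mul_zero]
        intro h1
        apply hn
        have h0 : n 0 = m 0 := by
          rw [← h, h1] at h'
          exact_mod_cast add_right_cancel h'
        ext i
        fin_cases i
        · exact h0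
        · exact h1.symm
      · simp
  rw [this]
  exact mem_support_iff.1 hm

theorem eval_edgePoly_exp (p : MvPolynomial (Fin 2) ℂ) (r M : ℝ) (z : ℂ) :
    (edgePoly p r M).eval (exp z) = ∑ m ∈ p.support, p.coeff m * exp (m 1 * z) *
      if (m 0 + r * m 1 : ℝ) = M then 1 else 0 := by
  rw [edgePoly, Polynomial.eval_finsetSum]
  refine Finset.sum_congr rfl fun m _ => ?_
  split_ifs <;> simp [← Complex.exp_nat_mul]

-- `E` has a nonzero root, hence one of the form e^c; it is isolated because exp has nonzero
-- derivative.
open Filter Topology Metric in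
theorem exists_isolated_zero_exp {E : Polynomial ℂ} (h0 : E.coeff 0 ≠ 0) {k : ℕ} (hk : k ≠ 0)
    (hE : E.coeff k ≠ 0) : ∃ c : ℂ, ∃ ρ > 0, E.eval (exp c) = 0 ∧
      ∀ z ∈ sphere c ρ, E.eval (exp z) ≠ 0 := by
  have hdeg : E.degree ≠ 0 := by
    have := Polynomial.le_degree_of_ne_zero hE
    intro h
    rw [h] at this
    exact hk (by exact_mod_cast Nat.le_zero.1 (by exact_mod_cast this))
  obtain ⟨u, hu⟩ := IsAlgClosed.exists_root E hdeg
  have hu0 : u ≠ 0 := by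
    rintro rfl
    exact h0 (by rw [Polynomial.coeff_zero_eq_eval_zero]; exact hu)
  have hE0 : E ≠ 0 := by
    rintro rfl
    simp at h0
  have hev : ∀ᶠ v in 𝓝[≠] u, E.eval v ≠ 0 := by
    have hfin : {v | E.IsRoot v}.Finite := E.finite_setOfPred_isRoot hE0
    have := (hfin.subset (Set.sdiff_subset (t := {u}))).isClosed.isOpen_compl.mem_nhds
      (x := u) (by simp)
    filter_upwards [mem_nhdsWithin_of_mem_nhds this, self_mem_nhdsWithin] with v hv hvu h
    exact hv ⟨h, hvu⟩
  have ht := ((Complex.hasDerivAt_exp (log u)).tendsto_nhdsNE (Complex.exp_ne_zero _))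
  rw [Complex.exp_log hu0] at ht
  have := ht.eventually hev
  rw [eventually_nhdsWithin_iff, Metric.eventually_nhds_iff] at this
  obtain ⟨ε, hε, h⟩ := this
  refine ⟨log u, ε / 2, by positivity, by rw [Complex.exp_log hu0]; exact hu, fun z hz => ?_⟩
  rw [mem_sphere] at hz
  refine h (by rw [hz]; linarith) ?_
  rintro rfl
  rw [dist_self] at hz
  linarith

/-! ### Asymptotics along the approximate solutions -/

/-- The branch `log (2π(j+1)) + iπ/2` of the logarithm of `2πi(j+1)`. -/
noncomputable def logBase (j : ℕ) : ℂ :=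
  (Real.log (2 * Real.pi * (j + 1)) : ℝ) + (Real.pi / 2 : ℝ) * I

/-- The value of `exp w` at the point `w = approxPt K r j z`. -/
noncomputable def expApprox (K : ℕ) (r : ℝ) (j : ℕ) (z : ℂ) : ℂ :=
  2 * Real.pi * I * K + r * logBase j + z

/-- A point with `exp w = expApprox K r j z` near `2πi(j+1)`. -/
noncomputable def approxPt (K : ℕ) (r : ℝ) (j : ℕ) (z : ℂ) : ℂ :=
  2 * Real.pi * I * (j + 1) + log (expApprox K r j z)

theorem exp_logBase (j : ℕ) : exp (logBase j) = 2 * Real.pi * I * (j + 1) := by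
  have h : (0 : ℝ) < 2 * Real.pi * (j + 1) := by positivity
  rw [logBase, Complex.exp_add, ← Complex.ofReal_exp, Real.exp_log h, Complex.ofReal_div,
    Complex.ofReal_ofNat, Complex.exp_pi_div_two_mul_I]
  push_cast
  ring

theorem norm_exp_logBase (j : ℕ) : ‖exp (logBase j)‖ = 2 * Real.pi * (j + 1) := by
  rw [Complex.norm_exp, logBase]
  simp only [add_re, ofReal_re, re_ofReal_mul, I_re, mul_zero, add_zero]
  exact Real.exp_log (by positivity)

theorem exp_approxPt {K : ℕ} {r : ℝ} {j : ℕ} {z : ℂ} (h : expApprox K r j z ≠ 0) :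
    exp (approxPt K r j z) = expApprox K r j z := by
  have : exp (2 * Real.pi * I * (j + 1)) = 1 := by
    rw [Complex.exp_eq_one_iff]
    exact ⟨j + 1, by push_cast; ring⟩
  rw [approxPt, Complex.exp_add, this, one_mul, Complex.exp_log h]

theorem exp_expApprox (K : ℕ) (r : ℝ) (j : ℕ) (z : ℂ) :
    exp (expApprox K r j z) = exp (r * logBase j) * exp z := by
  have : exp (2 * Real.pi * I * K) = 1 := by
    rw [Complex.exp_eq_one_iff]
    exact ⟨K, by push_cast; ring⟩
  rw [expApprox, Complex.exp_add, Complex.exp_add, this, one_mul]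

/-- Im `logBase j` is the constant π/2, so one `K` serves all `j`, keeping the logarithm off its
branch cut. -/
theorem one_le_im_expApprox {K : ℕ} {r R : ℝ} (hK : |r| * Real.pi + R + 1 ≤ K) (j : ℕ) {z : ℂ}
    (hz : ‖z‖ ≤ R) : 1 ≤ (expApprox K r j z).im := by
  have him : (expApprox K r j z).im = 2 * Real.pi * K + r * (Real.pi / 2) + z.im := by
    simp [expApprox, logBase]
  have h1 := (abs_le.1 ((Complex.abs_im_le_norm z).trans hz)).1
  have h2 := neg_abs_le r
  have hpi := Real.pi_gt_three
  have hK0 : (0 : ℝ) ≤ K := by positivity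
  have h3 : (K : ℝ) ≤ 2 * Real.pi * K := by nlinarith
  have h4 := mul_le_mul_of_nonneg_right h2 (by positivity : 0 ≤ Real.pi / 2)
  have h5 := mul_nonneg (abs_nonneg r) Real.pi_pos.le
  rw [him]
  linarith

theorem norm_expApprox_le (K : ℕ) (r : ℝ) (j : ℕ) {R : ℝ} {z : ℂ} (hz : ‖z‖ ≤ R) :
    ‖expApprox K r j z‖ ≤ 2 * Real.pi * K + |r| * ‖logBase j‖ + R := by
  refine (norm_add_le _ _).trans (add_le_add ((norm_add_le _ _).trans ?_) hz)
  simp [abs_of_pos Real.pi_pos]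

theorem norm_log_le {s : ℂ} (h : 1 ≤ ‖s‖) : ‖log s‖ ≤ ‖s‖ + Real.pi := by
  refine (Complex.norm_le_abs_re_add_abs_im _).trans (add_le_add ?_ ?_)
  · rw [Complex.log_re, abs_of_nonneg (Real.log_nonneg h)]
    linarith [Real.log_le_sub_one_of_pos (by linarith : 0 < ‖s‖)]
  · rw [Complex.log_im]
    exact Complex.abs_arg_le_pi s

open Filter Topology in
theorem tendsto_logBase_div :
    Tendsto (fun j : ℕ => ‖logBase j‖ / (2 * Real.pi * (j + 1))) atTop (𝓝 0) := by
  have ha : Tendsto (fun j : ℕ => 2 * Real.pi * ((j : ℝ) + 1)) atTop atTop :=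
    (tendsto_natCast_atTop_atTop.atTop_add tendsto_const_nhds).const_mul_atTop (by positivity)
  have h1 : Tendsto (fun x : ℝ => Real.log x / x) atTop (𝓝 0) :=
    Real.isLittleO_log_id_atTop.tendsto_div_nhds_zero
  have h2 : Tendsto (fun x : ℝ => Real.pi / 2 / x) atTop (𝓝 0) :=
    tendsto_const_nhds.div_atTop tendsto_id
  have h3 := (h1.norm.add h2).comp ha
  simp only [norm_zero, add_zero] at h3
  refine squeeze_zero (fun j => by positivity) (fun j => ?_) h3
  have hp : (0 : ℝ) < 2 * Real.pi * (j + 1) := by positivity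
  simp only [Function.comp_apply]
  rw [norm_div, Real.norm_of_nonneg hp.le, ← add_div]
  gcongr
  refine (norm_add_le _ _).trans (le_of_eq ?_)
  rw [norm_mul, Complex.norm_I, mul_one, Complex.norm_real, Complex.norm_real,
    Real.norm_of_nonneg (by positivity : 0 ≤ Real.pi / 2)]

section Limits
open Filter Topology Metric

variable {K : ℕ} {r R : ℝ}

theorem tendsto_bound_div (C D : ℝ) :
    Tendsto (fun j : ℕ => (D * ‖logBase j‖ + C) / (2 * Real.pi * (j + 1))) atTop (𝓝 0) := by
  have ha : Tendsto (fun j : ℕ => 2 * Real.pi * ((j : ℝ) + 1)) atTop atTop :=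
    (tendsto_natCast_atTop_atTop.atTop_add tendsto_const_nhds).const_mul_atTop (by positivity)
  have h := (tendsto_logBase_div.const_mul D).add ((tendsto_const_nhds (x := C)).div_atTop ha)
  simp only [mul_zero, add_zero] at h
  refine h.congr fun j => ?_
  ring

/-- The product with the principal filter encodes uniformity in z. -/
theorem tendsto_expApprox_div (K : ℕ) (r R : ℝ) :
    Tendsto (fun q : ℕ × ℂ => expApprox K r q.1 q.2 / exp (logBase q.1))
      (atTop ×ˢ 𝓟 (closedBall 0 R)) (𝓝 0) := by
  refine squeeze_zero_norm' ?_ ((tendsto_bound_div (2 * Real.pi * K + R) |r|).comp tendsto_fst)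
  have : ∀ᶠ q : ℕ × ℂ in atTop ×ˢ 𝓟 (closedBall 0 R), q.2 ∈ closedBall (0 : ℂ) R :=
    tendsto_snd.eventually (mem_principal_self _)
  filter_upwards [this] with q hq
  rw [mem_closedBall_zero_iff] at hq
  rw [norm_div, norm_exp_logBase, Function.comp_apply]
  gcongr
  linarith [norm_expApprox_le K r q.1 hq]

theorem tendsto_approxPt_div (hK : |r| * Real.pi + R + 1 ≤ K) :
    Tendsto (fun q : ℕ × ℂ => approxPt K r q.1 q.2 / exp (logBase q.1))
      (atTop ×ˢ 𝓟 (closedBall 0 R)) (𝓝 1) := by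
  have h : Tendsto (fun q : ℕ × ℂ => log (expApprox K r q.1 q.2) / exp (logBase q.1))
      (atTop ×ˢ 𝓟 (closedBall 0 R)) (𝓝 0) := by
    refine squeeze_zero_norm'
      ?_ ((tendsto_bound_div (2 * Real.pi * K + R + Real.pi) |r|).comp tendsto_fst)
    have : ∀ᶠ q : ℕ × ℂ in atTop ×ˢ 𝓟 (closedBall 0 R), q.2 ∈ closedBall (0 : ℂ) R :=
      tendsto_snd.eventually (mem_principal_self _)
    filter_upwards [this] with q hq
    rw [mem_closedBall_zero_iff] at hq
    rw [norm_div, norm_exp_logBase, Function.comp_apply]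
    gcongr
    have h1 := one_le_im_expApprox hK q.1 hq
    have h2 := norm_log_le (h1.trans ((le_abs_self _).trans (Complex.abs_im_le_norm _)))
    linarith [norm_expApprox_le K r q.1 hq]
  have h' := h.const_add 1
  rw [add_zero] at h'
  refine h'.congr fun q => ?_
  rw [approxPt, ← exp_logBase, add_div, div_self (Complex.exp_ne_zero _)]

/-- The normalised value of `p` at `(w, exp (exp w))` for `w = approxPt K r j z`. -/
noncomputable def scaledEval (p : MvPolynomial (Fin 2) ℂ) (K : ℕ) (r M : ℝ) (j : ℕ) (z : ℂ) : ℂ :=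
  ∑ m ∈ p.support, p.coeff m * exp (m 1 * z) *
    (exp (((m 0 + r * m 1 - M : ℝ) : ℂ) * logBase j) *
      (approxPt K r j z / exp (logBase j)) ^ m 0)

/-- With N = e^{`logBase j`}, monomial m has size N^{m₀ + r m₁}; the factor N^M is split off. -/
theorem scaledEval_mul_exp (p : MvPolynomial (Fin 2) ℂ) {K : ℕ} {r : ℝ} (M : ℝ) {j : ℕ} {z : ℂ}
    (h : expApprox K r j z ≠ 0) :
    scaledEval p K r M j z * exp (M * logBase j) =
      eval ![approxPt K r j z, exp (exp (approxPt K r j z))] p := by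
  rw [exp_approxPt h, exp_expApprox, eval_eq', scaledEval, Finset.sum_mul]
  refine Finset.sum_congr rfl fun m _ => ?_
  have h1 : exp (((m 0 + r * m 1 - M : ℝ) : ℂ) * logBase j) * exp (M * logBase j) =
      exp (logBase j) ^ m 0 * exp (r * logBase j) ^ m 1 := by
    rw [← Complex.exp_nat_mul, ← Complex.exp_nat_mul, ← Complex.exp_add, ← Complex.exp_add]
    congr 1
    push_cast
    ring
  have h2 : exp (m 1 * z) = exp z ^ m 1 := Complex.exp_nat_mul _ _
  have h3 := Complex.exp_ne_zero (logBase j)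
  rw [Fin.prod_univ_two, h2, div_pow]
  simp only [Matrix.cons_val_zero, Matrix.cons_val_one, Matrix.cons_val_fin_one]
  calc _ = p.coeff m * exp z ^ m 1 * (approxPt K r j z ^ m 0 / exp (logBase j) ^ m 0) *
        (exp (((m 0 + r * m 1 - M : ℝ) : ℂ) * logBase j) * exp (M * logBase j)) := by ring
    _ = _ := by
      rw [h1, mul_pow]
      field_simp

/-- Only monomials on the edge (δ = 0) survive in the limit. -/
theorem tendsto_exp_mul_logBase {δ : ℝ} (hδ : δ ≤ 0) :
    Tendsto (fun j : ℕ => exp ((δ : ℂ) * logBase j)) atTop (𝓝 (if δ = 0 then 1 else 0)) := by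
  split_ifs with h
  · simp [h]
  have hlt : δ < 0 := lt_of_le_of_ne hδ h
  rw [tendsto_zero_iff_norm_tendsto_zero]
  have ha : Tendsto (fun j : ℕ => 2 * Real.pi * ((j : ℝ) + 1)) atTop atTop :=
    (tendsto_natCast_atTop_atTop.atTop_add tendsto_const_nhds).const_mul_atTop (by positivity)
  have := Real.tendsto_exp_atBot.comp ((Real.tendsto_log_atTop.comp ha).const_mul_atTop_of_neg hlt)
  refine this.congr fun j => ?_
  rw [Complex.norm_exp, Complex.re_ofReal_mul]
  simp [logBase]

theorem tendstoUniformlyOn_scaledEval {p : MvPolynomial (Fin 2) ℂ} {M : ℝ}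
    (hM : ∀ m ∈ p.support, (m 0 + r * m 1 : ℝ) ≤ M) (hK : |r| * Real.pi + R + 1 ≤ K) :
    TendstoUniformlyOn (scaledEval p K r M) (fun z => (edgePoly p r M).eval (exp z)) atTop
      (closedBall 0 R) := by
  rw [tendstoUniformlyOn_iff_tendsto, tendsto_uniformity_iff_dist_tendsto_zero]
  have key : Tendsto (fun q : ℕ × ℂ => scaledEval p K r M q.1 q.2 -
      (edgePoly p r M).eval (exp q.2)) (atTop ×ˢ 𝓟 (closedBall 0 R)) (𝓝 0) := by
    simp only [scaledEval, eval_edgePoly_exp, ← Finset.sum_sub_distrib, ← mul_sub]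
    refine Eq.subst (motive := fun x : ℂ => Tendsto _ _ (𝓝 x)) Finset.sum_const_zero
      (tendsto_finsetSum p.support fun m hm => ?_)
    have h1 := (tendsto_exp_mul_logBase (sub_nonpos.2 (hM m hm))).comp
      (tendsto_fst (f := atTop) (g := 𝓟 (closedBall (0 : ℂ) R)))
    have h2 := h1.mul ((tendsto_approxPt_div hK).pow (m 0))
    rw [one_pow, mul_one] at h2
    have h3 := h2.sub_const (if (m 0 + r * m 1 : ℝ) - M = 0 then 1 else 0)
    simp only [sub_self, sub_eq_zero] at h3
    obtain ⟨C, hC⟩ := (isCompact_closedBall (0 : ℂ) R).exists_bound_of_continuousOn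
      (f := fun z => p.coeff m * exp (m 1 * z)) (by fun_prop)
    exact isBoundedUnder_le_mul_tendsto_zero
      ⟨C, eventually_map.2 ((tendsto_snd.eventually (mem_principal_self _)).mono
        fun q hq => hC q.2 hq)⟩ h3
  refine (tendsto_zero_iff_norm_tendsto_zero.1 key).congr fun q => ?_
  rw [dist_comm, dist_eq_norm]

theorem diffContOnCl_scaledEval (p : MvPolynomial (Fin 2) ℂ) (M : ℝ)
    (hK : |r| * Real.pi + R + 1 ≤ K) (j : ℕ) {c : ℂ} {ρ : ℝ} (hρ : ‖c‖ + ρ ≤ R) :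
    DiffContOnCl ℂ (scaledEval p K r M j) (ball c ρ) := by
  refine DifferentiableOn.diffContOnCl fun z hz => DifferentiableAt.differentiableWithinAt ?_
  have hz' := closure_ball_subset_closedBall hz
  have hzR : ‖z‖ ≤ R := by
    rw [mem_closedBall, dist_eq_norm] at hz'
    linarith [norm_le_norm_add_norm_sub' z c]
  have hs : expApprox K r j z ∈ slitPlane :=
    Or.inr (by linarith [one_le_im_expApprox hK j hzR] : 0 < (expApprox K r j z).im).ne'
  unfold scaledEval approxPt
  have hd : DifferentiableAt ℂ (fun z => log (expApprox K r j z)) z := by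
    refine DifferentiableAt.clog ?_ hs
    unfold expApprox
    fun_prop
  fun_prop

theorem exists_eval_exp_exp_eq_zero {p : MvPolynomial (Fin 2) ℂ} (hA : ∃ m ∈ p.support, m 1 = 0)
    (hB : ∃ m ∈ p.support, m 1 ≠ 0) {ε : ℝ} (hε : 0 < ε) :
    ∃ w : ℂ, eval ![w, exp (exp w)] p = 0 ∧ w ≠ 0 ∧ ‖exp w / w‖ < ε := by
  obtain ⟨r, M, hM, ⟨A, hA, hA1, hAM⟩, B, hB, hB1, hBM⟩ := exists_newton_edge hA hB
  obtain ⟨c, ρ, hρ, hc, hs⟩ := exists_isolated_zero_exp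
    (hA1 ▸ coeff_edgePoly_ne_zero hA hAM) hB1 (coeff_edgePoly_ne_zero hB hBM)
  set R := ‖c‖ + ρ with hR
  obtain ⟨K, hK⟩ := exists_nat_ge (|r| * Real.pi + R + 1)
  have hsub : closedBall c ρ ⊆ closedBall 0 R :=
    closedBall_subset_closedBall' (by rw [dist_zero_right]; linarith)
  have hz := exists_zero_of_tendstoUniformlyOn hρ
    (fun j => diffContOnCl_scaledEval p M hK j hR.ge)
    ((tendstoUniformlyOn_scaledEval hM hK).mono hsub)
    ((edgePoly p r M).continuous.comp Complex.continuous_exp |>.continuousOn) hc hs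
  have h1 := tendsto_approxPt_div hK
  have h2 := (tendsto_expApprox_div K r R).div h1 one_ne_zero
  rw [zero_div] at h2
  have h3 := (h1.eventually_ne one_ne_zero).and
    (h2.norm.eventually_lt_const (u := ε) (by rwa [norm_zero]))
  rw [eventually_prod_principal_iff] at h3
  obtain ⟨j, ⟨z, hz, hz0⟩, hj⟩ := (hz.and h3).exists
  obtain ⟨hj1, hj2⟩ := hj z (hsub hz)
  have him := one_le_im_expApprox hK j (mem_closedBall_zero_iff.1 (hsub hz))
  have hs0 : expApprox K r j z ≠ 0 := by
    intro h
    rw [h, Complex.zero_im] at him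
    linarith
  refine ⟨approxPt K r j z, ?_, ?_, ?_⟩
  · rw [← scaledEval_mul_exp p M hs0, hz0, zero_mul]
  · rintro h
    exact hj1 (by simp [h])
  · rw [exp_approxPt hs0]
    simpa [div_div_div_cancel_right₀ (Complex.exp_ne_zero _)] using hj2

end Limits

/-! ### Rationally dependent solutions -/

/-- Otherwise `X 1` divides `p`, so `p` is associated to `X 1` and does not involve `X 0`. -/
theorem exists_mem_support_apply_one_eq_zero {k : Type*} [Field k] {p : MvPolynomial (Fin 2) k}
    (hp : Irreducible p) (hx : 0 ∈ p.vars) : ∃ m ∈ p.support, m 1 = 0 := by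
  by_contra! h
  have hX : X 1 ∣ p := by
    rw [X_dvd_iff_modMonomial_eq_zero]
    ext m
    by_cases hm : Finsupp.single 1 1 ≤ m
    · rw [coeff_modMonomial_of_le _ hm, coeff_zero]
    · rw [coeff_modMonomial_of_not_le _ hm, coeff_zero]
      by_contra hc
      refine hm (Finsupp.single_le_iff.2 (Nat.one_le_iff_ne_zero.2 ?_))
      exact h m (mem_support_iff.2 hc)
  obtain ⟨u, hu⟩ := ((X_prime (i := (1 : Fin 2))).irreducible.associated_of_dvd hp hX).symm.dvd
  have hu0 : u ≠ 0 := by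
    rintro rfl
    rw [mul_zero] at hu
    exact X_ne_zero _ hu
  have hd : degreeOf 0 p = 0 := by
    have := congrArg (degreeOf 0) hu
    rw [degreeOf_mul_eq hp.ne_zero hu0, degreeOf_X_of_ne (by decide)] at this
    omega
  rw [degreeOf_def, Multiset.count_eq_zero] at hd
  rw [vars_def, Multiset.mem_toFinset] at hx
  exact hd hx

theorem exists_mem_support_apply_one_ne_zero {k : Type*} [Field k] {p : MvPolynomial (Fin 2) k}
    (hy : 1 ∈ p.vars) : ∃ m ∈ p.support, m 1 ≠ 0 := by
  obtain ⟨m, hm, h⟩ := (mem_vars_iff_mem_support 1).1 hy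
  exact ⟨m, hm, Finsupp.mem_support_iff.1 h⟩

/-- The relations of (x, y) form a prime containing `p`. Were it larger than (p) it would be
maximal, and the Nullstellensatz would make x algebraic. -/
theorem dvd_of_aeval_eq_zero_of_transcendental {F E : Type*} [Field F] [Field E] [Algebra F E]
    [IsAlgClosed E] {p g : MvPolynomial (Fin 2) (algebraicClosure F E)} (hp : Irreducible p)
    {x y : E} (hx : Transcendental F x) (h : aeval ![x, y] p = 0) (hg : aeval ![x, y] g = 0) :
    p ∣ g := by
  have hK : IsAlgClosed (algebraicClosure F E) := (algebraicClosure.isAlgClosure F E).1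
  let P := RingHom.ker (aeval (R := algebraicClosure F E) ![x, y])
  have hprime : P.IsPrime := RingHom.ker_isPrime _
  by_contra hd
  have hmax : P.IsMaximal := by
    refine isMaximal_of_irreducible_mem hp h fun hP => hd ?_
    rw [← Ideal.mem_span_singleton, ← hP]
    exact hg
  obtain ⟨a, ha⟩ := isMaximal_iff_eq_vanishingIdeal_singleton.1 hmax
  have hmem : X 0 - C (a 0) ∈ P := by
    rw [ha]
    simp
  have hxa : x = algebraMap (algebraicClosure F E) E (a 0) := by
    have : aeval ![x, y] (X 0 - C (a 0)) = 0 := hmem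
    rw [map_sub, aeval_X, aeval_C, sub_eq_zero] at this
    exact this
  exact hx (hxa ▸ mem_algebraicClosure_iff.1 (a 0).2)

theorem exp_exp_pow_den_eq {w : ℂ} {q : ℚ} (h : exp w = q * w) :
    exp (exp w) ^ q.den = (q * w) ^ q.num := by
  rw [← h, ← Complex.exp_nat_mul, ← Complex.exp_int_mul, h]
  congr 1
  rw [← mul_assoc]
  congr 1
  rw [mul_comm]
  exact_mod_cast q.mul_den_eq_num

theorem pow_mul_pow_eq_of_zpow {x y : ℂ} (hx : x ≠ 0) {n : ℕ} {m : ℤ} :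
    y ^ n * x ^ (-m).toNat = x ^ m.toNat ↔ y ^ n = x ^ m := by
  have h : x ^ m = x ^ m.toNat / x ^ (-m).toNat := by
    rw [← zpow_natCast, ← zpow_natCast, ← zpow_sub₀ hx]
    congr 1
    omega
  rw [h, eq_div_iff (pow_ne_zero _ hx)]

theorem IsAlgebraic.of_zpow {F E : Type*} [Field F] [Field E] [Algebra F E] {x : E} {k : ℤ}
    (hk : k ≠ 0) (h : IsAlgebraic F (x ^ k)) : IsAlgebraic F x := by
  rcases k with n | n
  · exact _root_.IsAlgebraic.of_pow (Nat.pos_of_ne_zero (by simpa using hk)) (by simpa using h)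
  · rw [zpow_negSucc] at h
    exact _root_.IsAlgebraic.of_pow n.succ_pos (by simpa using h.inv)

theorem eq_of_exp_eq_mul {p : MvPolynomial (Fin 2) (algebraicClosure ℚ ℂ)} (hp : Irreducible p)
    {w₁ w₂ : ℂ} {q₁ q₂ : ℚ} (h₁ : aeval ![w₁, exp (exp w₁)] p = 0)
    (h₂ : aeval ![w₂, exp (exp w₂)] p = 0) (hw₁ : Transcendental ℚ w₁)
    (hw₂ : Transcendental ℚ w₂) (he₁ : exp w₁ = q₁ * w₁) (he₂ : exp w₂ = q₂ * w₂) : q₁ = q₂ := by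
  have hn (w : ℂ) (q : ℚ) (h : exp w = q * w) : (q : ℂ) * w ≠ 0 := h ▸ Complex.exp_ne_zero w
  have hr₁ := exp_exp_pow_den_eq he₁
  have hr₂ := (pow_mul_pow_eq_of_zpow (hn _ _ he₂)).2 (exp_exp_pow_den_eq he₂)
  have hq₁ := left_ne_zero_of_mul (hn _ _ he₁)
  have hq₂ := left_ne_zero_of_mul (hn _ _ he₂)
  have hw0 := right_ne_zero_of_mul (hn _ _ he₁)
  -- The curve y^d = (q₂x)^n, cleared of negative exponents.
  let g : MvPolynomial (Fin 2) (algebraicClosure ℚ ℂ) :=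
    X 1 ^ q₂.den * (C (q₂ : algebraicClosure ℚ ℂ) * X 0) ^ (-q₂.num).toNat -
      (C (q₂ : algebraicClosure ℚ ℂ) * X 0) ^ q₂.num.toNat
  have hg (x y : ℂ) : aeval ![x, y] g =
      y ^ q₂.den * (q₂ * x) ^ (-q₂.num).toNat - (q₂ * x) ^ q₂.num.toNat := by
    simp [g]
  obtain ⟨u, hu⟩ := dvd_of_aeval_eq_zero_of_transcendental hp hw₂ h₂
    ((hg _ _).trans (sub_eq_zero.2 hr₂))
  have hr := hg w₁ (exp (exp w₁))
  rw [hu, map_mul, h₁, zero_mul, eq_comm, sub_eq_zero,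
    pow_mul_pow_eq_of_zpow (mul_ne_zero hq₂ hw0)] at hr
  -- Now (w₁, e^{e^{w₁}}) lies on both curves; eliminate y.
  have hk : w₁ ^ (q₁.num * q₂.den - q₂.num * q₁.den) =
      ((q₂ ^ (q₂.num * q₁.den) / q₁ ^ (q₁.num * q₂.den) : ℚ) : ℂ) := by
    have e : ((q₁ : ℂ) * w₁) ^ (q₁.num * q₂.den) = (q₂ * w₁) ^ (q₂.num * q₁.den) := by
      rw [zpow_mul, ← hr₁, zpow_mul, ← hr, zpow_natCast, zpow_natCast, ← pow_mul, ← pow_mul,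
        mul_comm]
    rw [mul_zpow, mul_zpow] at e
    push_cast
    rw [zpow_sub₀ hw0, div_eq_div_iff (zpow_ne_zero _ hw0) (zpow_ne_zero _ hq₁), mul_comm, e]
  by_contra hne
  refine hw₁ (IsAlgebraic.of_zpow (k := q₁.num * q₂.den - q₂.num * q₁.den) ?_ ?_)
  · rw [sub_ne_zero]
    intro h
    exact hne (Rat.eq_iff_mul_eq_mul.2 h)
  · rw [hk]
    exact isAlgebraic_algebraMap (A := ℂ) (q₂ ^ (q₂.num * q₁.den) / q₁ ^ (q₁.num * q₂.den) : ℚ)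

/-- For algebraic w ≠ 0 both w and e^w would be algebraic, against Schanuel with n = 1. -/
theorem transcendental_of_exp_eq_mul (hSC : SchanuelConjecture) {w : ℂ} {q : ℚ}
    (h : exp w = q * w) : Transcendental ℚ w := by
  intro hw
  have hw0 : w ≠ 0 := by
    rintro rfl
    simp at h
  have h1 := hSC 1 ![w] (by simpa using hw0)
  have h2 : td (Set.range ![w] ∪ Set.range fun i => exp (![w] i)) ≤ Cardinal.mk (∅ : Set ℂ) := by
    refine td_le_card ?_
    rintro x (⟨i, rfl⟩ | ⟨i, rfl⟩)
    · simpa using hw.adjoin_of_rat ∅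
    · simp only [Matrix.cons_val_fin_one, h]
      exact ((isAlgebraic_algebraMap (A := ℂ) q).mul hw).adjoin_of_rat ∅
  have := h1.trans h2
  simp at this

/-! ### Transcendence degree of the point and conclusion -/

theorem range_expPoint (w : ℂ) : Set.range (expPoint w) = {w, exp w, exp (exp w)} := by
  ext x
  simp only [Set.mem_range, Sum.exists, expPoint, Sum.elim_inl, Sum.elim_inr, Fin.exists_fin_two,
    Matrix.cons_val_zero, Matrix.cons_val_one, Matrix.cons_val_fin_one, Set.mem_insert_iff,
    Set.mem_singleton_iff, eq_comm (b := x)]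
  tauto

theorem td_expPoint_le_two {p : MvPolynomial (Fin 2) (algebraicClosure ℚ ℂ)} (hp : p ≠ 0) {w : ℂ}
    (h : aeval ![w, exp (exp w)] p = 0) : td (Set.range (expPoint w)) ≤ 2 := by
  have hcard (a b : ℂ) : Cardinal.mk ({a, b} : Set ℂ) ≤ 2 := by
    refine (Cardinal.mk_insert_le).trans ?_
    rw [Cardinal.mk_singleton, one_add_one_eq_two]
  rw [range_expPoint]
  rcases isAlgebraic_or_of_aeval_eq_zero hp h with hw | hy
  · refine (td_le_card (T := {exp w, exp (exp w)}) ?_).trans (hcard _ _)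
    rintro x (rfl | hx)
    · exact hw.adjoin_of_rat _
    · exact isAlgebraic_adjoin_of_mem hx
  · refine (td_le_card (T := {w, exp w}) ?_).trans (hcard _ _)
    rintro x (rfl | rfl | rfl)
    · exact isAlgebraic_adjoin_of_mem (by simp)
    · exact isAlgebraic_adjoin_of_mem (by simp)
    · exact isAlgebraic_adjoin_mono (by simp) hy

theorem td_expPoint_le_one {w : ℂ} (h : ¬ LinearIndependent ℚ ![w, exp w]) :
    td (Set.range (expPoint w)) ≤ 1 := by
  rw [range_expPoint]
  by_cases hw : w = 0
  -- The point is (0, 1, 1, e), so e alone generates.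
  · subst hw
    rw [← Cardinal.mk_singleton (exp (exp 0))]
    refine td_le_card ?_
    rintro x (rfl | rfl | rfl)
    · exact isAlgebraic_zero
    · rw [Complex.exp_zero]
      exact isAlgebraic_one
    · exact isAlgebraic_adjoin_of_mem rfl
  · rw [LinearIndependent.pair_iff' hw] at h
    push Not at h
    obtain ⟨q, hq⟩ := h
    rw [Rat.smul_def, eq_comm] at hq
    rw [← Cardinal.mk_singleton w]
    have h0 : (q : ℂ) * w ≠ 0 := hq ▸ Complex.exp_ne_zero w
    have hqw : IsAlgebraic (IntermediateField.adjoin ℚ {w}) ((q : ℂ) * w) :=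
      ((isAlgebraic_algebraMap (A := ℂ) q).adjoin_of_rat _).mul (isAlgebraic_adjoin_of_mem rfl)
    refine td_le_card ?_
    rintro x (rfl | rfl | rfl)
    · exact isAlgebraic_adjoin_of_mem rfl
    · rw [hq]
      exact hqw
    · exact hqw.of_pow_mul_eq_pow q.den_nz h0
        ((pow_mul_pow_eq_of_zpow h0).2 (exp_exp_pow_den_eq hq))

theorem two_le_td_expPoint (hSC : SchanuelConjecture) {w : ℂ}
    (h : LinearIndependent ℚ ![w, exp w]) : 2 ≤ td (Set.range (expPoint w)) := by
  have := hSC 2 _ h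
  have hr : Set.range ![w, exp w] ∪ Set.range (fun i => exp (![w, exp w] i)) =
      Set.range (expPoint w) := by
    rw [range_expPoint]
    ext x
    simp only [Set.mem_union, Set.mem_range, Fin.exists_fin_two,
      Matrix.cons_val_zero, Matrix.cons_val_one, Matrix.cons_val_fin_one, Set.mem_insert_iff,
      Set.mem_singleton_iff, eq_comm (b := x)]
    tauto
  rw [hr] at this
  exact_mod_cast this

theorem td_expPoint_eq_two_iff (hSC : SchanuelConjecture)
    {p : MvPolynomial (Fin 2) (algebraicClosure ℚ ℂ)} (hp : p ≠ 0) {w : ℂ}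
    (h : aeval ![w, exp (exp w)] p = 0) :
    td (Set.range (expPoint w)) = 2 ↔ LinearIndependent ℚ ![w, exp w] := by
  refine ⟨fun h2 => ?_, fun hi => le_antisymm (td_expPoint_le_two hp h)
    (two_le_td_expPoint hSC hi)⟩
  by_contra hi
  have := td_expPoint_le_one hi
  rw [h2] at this
  exact absurd this (by norm_num)

theorem exists_linearIndependent_solution (hSC : SchanuelConjecture)
    {p : MvPolynomial (Fin 2) (algebraicClosure ℚ ℂ)} (hp : Irreducible p)
    (hA : ∃ m ∈ p.support, m 1 = 0) (hB : ∃ m ∈ p.support, m 1 ≠ 0) :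
    ∃ w : ℂ, aeval ![w, exp (exp w)] p = 0 ∧ LinearIndependent ℚ ![w, exp w] := by
  have key {ε : ℝ} (hε : 0 < ε) :
      ∃ w : ℂ, aeval ![w, exp (exp w)] p = 0 ∧ w ≠ 0 ∧ ‖exp w / w‖ < ε := by
    have hsupp : (map (algebraMap (algebraicClosure ℚ ℂ) ℂ) p).support = p.support :=
      support_map_of_injective _ (algebraMap (algebraicClosure ℚ ℂ) ℂ).injective
    obtain ⟨w, h, h'⟩ := exists_eval_exp_exp_eq_zero (hsupp.symm ▸ hA) (hsupp.symm ▸ hB) hε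
    exact ⟨w, by rwa [aeval_def, ← eval_map], h'⟩
  by_contra! hc
  have hdep {w : ℂ} (h : aeval ![w, exp (exp w)] p = 0) (hw : w ≠ 0) :
      ∃ q : ℚ, exp w = q * w := by
    have := hc w h
    rw [LinearIndependent.pair_iff' hw] at this
    push Not at this
    obtain ⟨q, hq⟩ := this
    exact ⟨q, by rw [← hq, Rat.smul_def]⟩
  obtain ⟨w₁, h₁, hw₁, -⟩ := key one_pos
  obtain ⟨q₁, hq₁⟩ := hdep h₁ hw₁
  -- A strictly smaller ratio than that of `w₁` forces `q₂ ≠ q₁`.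
  obtain ⟨w₂, h₂, hw₂, hlt⟩ := key (norm_pos_iff.2 (div_ne_zero (Complex.exp_ne_zero w₁) hw₁))
  obtain ⟨q₂, hq₂⟩ := hdep h₂ hw₂
  have := eq_of_exp_eq_mul hp h₁ h₂ (transcendental_of_exp_eq_mul hSC hq₁)
    (transcendental_of_exp_eq_mul hSC hq₂) hq₁ hq₂
  rw [hq₁, hq₂, this, mul_div_cancel_right₀ _ hw₁, mul_div_cancel_right₀ _ hw₂] at hlt
  exact lt_irrefl _ hlt

theorem expPoint_mem_varietyOf {p : MvPolynomial (Fin 2) (algebraicClosure ℚ ℂ)} {w : ℂ}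
    (h : aeval ![w, exp (exp w)] p = 0) : expPoint w ∈ varietyOf p ∩ expGraph 2 := by
  refine ⟨⟨fun i => ?_, h, rfl⟩, fun i => ?_⟩ <;> fin_cases i
  · exact Complex.exp_ne_zero _
  · exact Complex.exp_ne_zero _
  · rfl
  · rfl

theorem mainTheorem3 (hSC : SchanuelConjecture)
    (p : MvPolynomial (Fin 2) (algebraicClosure ℚ ℂ)) (hp : Irreducible p)
    (hx : 0 ∈ p.vars) (hy : 1 ∈ p.vars) :
    algDim (varietyOf p) = 2 ∧
    (∃ w : ℂ, expPoint w ∈ varietyOf p ∩ expGraph 2 ∧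
      IsGenericPt (varietyOf p) (expPoint w) ∧
      td (Set.range (expPoint w)) = 2) ∧
    (∃ w : ℂ, aeval ![w, exp (exp w)] p = 0 ∧ LinearIndependent ℚ ![w, exp w]) ∧
    (∀ w : ℂ, aeval ![w, exp (exp w)] p = 0 →
      (td (Set.range (expPoint w)) = 2 ↔ LinearIndependent ℚ ![w, exp w])) := by
  have hA := exists_mem_support_apply_one_eq_zero hp hx
  have hB := exists_mem_support_apply_one_ne_zero hy
  have hdim := le_antisymm (algDim_varietyOf_le hp.ne_zero) (two_le_algDim_varietyOf hA hB)
  obtain ⟨w, hw, hi⟩ := exists_linearIndependent_solution hSC hp hA hB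
  have htd := (td_expPoint_eq_two_iff hSC hp.ne_zero hw).2 hi
  have hmem := expPoint_mem_varietyOf hw
  refine ⟨hdim, ⟨w, hmem, ⟨hmem.1, ?_⟩, htd⟩, ⟨w, hw, hi⟩,
    fun w hw => td_expPoint_eq_two_iff hSC hp.ne_zero hw⟩
  rw [hdim, htd]
  simp
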